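/- Let $(\Omega,\mathscr F,\mathcal P)$ be a probability space, $Y:\Omega\to\mathbb R^M$ a random element, $\mathscr Y=\sigma\{Y\}\subseteq\mathscr F$, and let $g:\Omega\times\mathbb R^N\to\mathbb R$ be such that $\mathbb E\{g(\cdot,x)\}$ exists for all $x\in\mathbb R^N$. (For an extended real valued function $f$, "$\mathbb E\{f\}$ exists" means that $f$ is $\mathscr F$-measurable and that $\mathbb E\{f^+\},\mathbb E\{f^-\}$ are not both infinite; then $\mathbb E\{f\}=\mathbb E\{f^+\}-\mathbb E\{f^-\}\in[-\infty,\infty]$.) Let $\mathcal X:\mathbb R^N\rightrightarrows\mathbb R^N$ be a multifunction with $\mathcal X(z)\neq\varnothing$ for every $z\in\mathbb R^N$, and let $Z_Y:\Omega\to\mathbb R^N$ be a function. Assume: C1. $\mathcal X$ is compact-valued and closed, i.e. $x_k\to x$, $y_k\to y$ and $x_k\in\mathcal X(y_k)$ for all $k$ imply $x\in\mathcal X(y)$; C2. $Z_Y$ is $\mathscr Y$-measurable. Let $\mathcal F$ be the set of all $\mathscr Y$-measurable $X:\Omega\to\mathbb R^N$ such that $X(\omega)\in\mathcal X(Z_Y(\omega))$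 for $\mathcal P$-almost every $\omega$. Then $\mathcal F$ is nonempty. Suppose in addition: C3. $\mathbb E\{g(\cdot,X)\}$ exists for all $X\in\mathcal F$, and $\inf_{X\in\mathcal F}\mathbb E\{g(\cdot,X)\}<+\infty$; C4. there is a $\mathcal P$-integrable $\psi:\Omega\to\mathbb R$ with $|g(\omega,x)|\le\psi(\omega)$ for all $(\omega,x)\in\Omega\times\mathbb R^N$; C5. $g$ is Carathéodory, i.e. $g(\cdot,x)$ is $\mathscr F$-measurable for every $x$ and $g(\omega,\cdot)$ is continuous for every $\omega$; C6. $h:\mathbb R^M\times\mathbb R^N\to[-\infty,\infty]$ is such that, for every $x$, $h(Y,x)$ is a ($\mathscr Y$-measurable) version of $\mathbb E\{g(\cdot,x)\,|\,\mathscr Y\}$, and $(\omega,x)\mapsto h(Y(\omega),x)$ is Carathéodory on $\Omega\times\mathbb R^N$ as an extended real valued function; this version of the conditional expectation is used below. Then the optimal value function $\vartheta(\omega)=\inf_{x\in\mathcal X(Z_Y(\omega))}h(Y(\omega),x)$ is $\mathscr Y$-measurable, $\mathbb E\{\vartheta\}$ exists, and $$\inf_{X\in\mathcal F}\mathbb E\{g(\cdot,X)\}=\mathbb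 E\{\vartheta\}=\mathbb E\{g(\cdot,X^*)\}$$ for at least one $X^*\in\mathcal F$ such that $X^*(\omega)\in\arg\min_{x\in\mathcal X(Z_Y(\omega))}h(Y(\omega),x)$ for every $\omega\in\Omega$. Moreover, if $X:\Omega\to\mathbb R^N$ is such that, for every $\omega\in\Omega$, $X(\omega)$ is the only minimizer of $h(Y(\omega),\cdot)$ over $\mathcal X(Z_Y(\omega))$, then $X$ is $\mathscr Y$-measurable. -/

import Mathlib

open MeasureTheory Filter Topology
open scoped ENNReal

namespace FundLemma

/-- The Euclidean space `ℝⁿ`. -/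
abbrev Rn (n : ℕ) : Type := EuclideanSpace ℝ (Fin n)

noncomputable section

/-- `H : Ω × S → T` is Carathéodory with respect to the σ-algebra `m` on `Ω`: measurable in `ω`
for every fixed `x`, continuous in `x` for every fixed `ω`. -/
def IsCaratheodory {Ω S T : Type*} (m : MeasurableSpace Ω) [TopologicalSpace S]
    [TopologicalSpace T] [MeasurableSpace T] (H : Ω → S → T) : Prop :=
  (∀ x, Measurable[m] (fun ω => H ω x)) ∧ ∀ ω, Continuous (H ω)

/-- The domain of a multifunction: the points where its value is nonempty. -/
def multiDom {S T : Type*} (𝒳 : S → Set T) : Set S := {y | (𝒳 y).Nonempty}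

/-- A closed multifunction: it is closed-valued, and `xₖ → x`, `yₖ → y`, `xₖ ∈ 𝒳 yₖ` for all `k`
imply `x ∈ 𝒳 y`. -/
def IsClosedMultifunction {S T : Type*} [TopologicalSpace S] [TopologicalSpace T]
    (𝒳 : S → Set T) : Prop :=
  (∀ y, IsClosed (𝒳 y)) ∧
    ∀ (xs : ℕ → T) (ys : ℕ → S) (x : T) (y : S),
      Tendsto xs atTop (𝓝 x) → Tendsto ys atTop (𝓝 y) → (∀ k, xs k ∈ 𝒳 (ys k)) → x ∈ 𝒳 y

/-- The expectation of the extended real valued `f` exists: `f` is measurable and the integrals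
of its positive and of its negative part are not both infinite. -/
def ExpectationExists {Ω : Type*} [MeasurableSpace Ω] (P : Measure Ω) (f : Ω → EReal) : Prop :=
  Measurable f ∧ (∫⁻ ω, (f ω).toENNReal ∂P < ∞ ∨ ∫⁻ ω, (-f ω).toENNReal ∂P < ∞)

/-- The expectation `𝔼 f = 𝔼 f⁺ - 𝔼 f⁻`, with values in `[-∞, ∞]`
(meaningful when `ExpectationExists P f`). -/
def expectation {Ω : Type*} [MeasurableSpace Ω] (P : Measure Ω) (f : Ω → EReal) : EReal :=
  ((∫⁻ ω, (f ω).toENNReal ∂P : ℝ≥0∞) : EReal) - ((∫⁻ ω, (-f ω).toENNReal ∂P : ℝ≥0∞) : EReal)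

/-- `G : Ω → [-∞, ∞]` is a version of the conditional expectation of the integrable `f` given the
sub-σ-algebra `m`: it is `m`-measurable and almost everywhere equal to `𝔼[f | m]`. -/
def IsCondExpVersion {Ω : Type*} [MeasurableSpace Ω] (P : Measure Ω) (m : MeasurableSpace Ω)
    (f : Ω → ℝ) (G : Ω → EReal) : Prop :=
  Measurable[m] G ∧ G =ᵐ[P] fun ω => (((P[f | m]) ω : ℝ) : EReal)

/-- The σ-algebra `σ{Y}` generated by a random element. -/
abbrev sigmaOf {Ω : Type*} {M : ℕ} (Y : Ω → Rn M) : MeasurableSpace Ω :=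
  MeasurableSpace.comap Y inferInstance

/-- The decision set: all `m`-measurable `X` with `X ω ∈ 𝒳 (Z ω)` for almost every `ω`. -/
def decisionSet {Ω : Type*} [MeasurableSpace Ω] (P : Measure Ω) (m : MeasurableSpace Ω) {N : ℕ}
    (𝒳 : Rn N → Set (Rn N)) (Z : Ω → Rn N) : Set (Ω → Rn N) :=
  {X | (∀ᵐ ω ∂P, X ω ∈ 𝒳 (Z ω)) ∧ Measurable[m] X}

/-- The minimizers of `f` over `A`. -/
def argminOn {S : Type*} (f : S → EReal) (A : Set S) : Set S :=
  {x | x ∈ A ∧ ∀ x' ∈ A, f x ≤ f x'}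

end

end FundLemma

namespace FundLemma

/-! For `X` measurable with respect to `σ{Y}`, the substitution rule `𝔼 g(·, X) = 𝔼 h(Y, X)` turns
the problem into pointwise minimization: `h(Y, X) ≥ ϑ` almost everywhere for feasible `X`, with
equality if `X` selects from the argmin. The rule (`integral_substitution`) passes from simple
functions to `X` by continuity and domination. A measurable minimizer exists because
hit-measurability holds for `𝒳 ∘ Z`, is inherited by argmin sets, and yields measurable selections
of compact-valued multifunctions. -/

/-- A multifunction is hit-measurable if the set of points where it meets a given compact set is
measurable. -/
def HitMeasurable {Ω T : Type*} [TopologicalSpace T] (m : MeasurableSpace Ω)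
    (Γ : Ω → Set T) : Prop :=
  ∀ K, IsCompact K → MeasurableSet[m] {ω | (Γ ω ∩ K).Nonempty}

/-! ### Measurable minimization and selection. -/

section Selection

variable {Ω T : Type*} {m : MeasurableSpace Ω}

/-- Countably many conditions replace the uncountable existential: dense points with value below `u
n`, ever closer to `Γ ω ∩ K`. Compactness of `K` produces the actual point in the limit. -/
theorem measurableSet_exists_le [PseudoMetricSpace T] [SecondCountableTopology T]
    {Γ : Ω → Set T} (hΓ : HitMeasurable m Γ) (hcl : ∀ ω, IsClosed (Γ ω))
    {f : Ω → T → EReal} (hf : IsCaratheodory m f) {K : Set T} (hK : IsCompact K) (a : EReal) :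
    MeasurableSet {ω | ∃ x ∈ Γ ω ∩ K, f ω x ≤ a} := by
  rcases eq_or_ne a ⊤ with rfl | ha
  · simpa [Set.Nonempty] using hΓ K hK
  obtain ⟨D, hDc, hD⟩ := TopologicalSpace.exists_countable_dense T
  -- The levels `u n > a` make the sublevel sets open, so that they contain dense points.
  obtain ⟨u, -, hu, hlim⟩ := exists_seq_strictAnti_tendsto' (lt_top_iff_ne_top.2 ha)
  have key : {ω | ∃ x ∈ Γ ω ∩ K, f ω x ≤ a} =
      ⋂ n : ℕ, ⋃ d ∈ D, {ω | (Γ ω ∩ (Metric.closedBall d (1 / (n + 1 : ℝ)) ∩ K)).Nonempty} ∩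
        {ω | f ω d < u n} := by
    ext ω
    simp only [Set.mem_ofPred_eq, Set.mem_iInter, Set.mem_iUnion, Set.mem_inter_iff, exists_prop]
    constructor
    · rintro ⟨x, ⟨hx, hxK⟩, hxa⟩ n
      have hopen : IsOpen (Metric.ball x (1 / (n + 1 : ℝ)) ∩ f ω ⁻¹' Set.Iio (u n)) :=
        Metric.isOpen_ball.inter (isOpen_Iio.preimage (hf.2 ω))
      obtain ⟨d, hd, hdD⟩ := hD.inter_open_nonempty _ hopen
        ⟨x, Metric.mem_ball_self (by positivity), hxa.trans_lt (hu n).1⟩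
      exact ⟨d, hdD, ⟨x, hx, Metric.mem_closedBall'.2 (Metric.mem_ball.1 hd.1).le, hxK⟩, hd.2⟩
    · intro H
      choose d _ hx hfd using H
      choose x hxΓ hxd hxK using hx
      obtain ⟨y, hyK, φ, hφ, hy⟩ := hK.tendsto_subseq hxK
      have hdist : Tendsto (fun n => dist ((x ∘ φ) n) ((d ∘ φ) n)) atTop (𝓝 0) := by
        refine squeeze_zero (fun _ => dist_nonneg) (fun n => Metric.mem_closedBall.1 (hxd (φ n))) ?_
        exact tendsto_one_div_add_atTop_nhds_zero_nat.comp hφ.tendsto_atTop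
      have hdy : Tendsto (d ∘ φ) atTop (𝓝 y) := (tendsto_iff_of_dist hdist).1 hy
      refine ⟨y, ⟨(hcl ω).mem_of_tendsto hy (Eventually.of_forall fun n => hxΓ _), hyK⟩, ?_⟩
      exact le_of_tendsto_of_tendsto' (((hf.2 ω).tendsto y).comp hdy)
        (hlim.comp hφ.tendsto_atTop) fun n => (hfd (φ n)).le
  rw [key]
  refine MeasurableSet.iInter fun n => MeasurableSet.biUnion hDc fun d _ => ?_
  exact (hΓ _ (hK.inter_left Metric.isClosed_closedBall)).inter
    (measurableSet_lt (hf.1 d) measurable_const)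

theorem exists_mem_argminOn [TopologicalSpace T] {f : T → EReal} (hf : Continuous f)
    {A : Set T} (hA : IsCompact A) (hne : A.Nonempty) : (argminOn f A).Nonempty := by
  obtain ⟨x, hx, hmin⟩ := hA.exists_isMinOn hne hf.continuousOn
  exact ⟨x, hx, fun y hy => hmin hy⟩

theorem biInf_eq_of_mem_argminOn {f : T → EReal} {A : Set T} {x : T} (hx : x ∈ argminOn f A) :
    ⨅ y ∈ A, f y = f x :=
  le_antisymm (iInf₂_le x hx.1) (le_iInf₂ hx.2)

theorem isCompact_argminOn [TopologicalSpace T] {f : T → EReal} (hf : Continuous f)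
    {A : Set T} (hA : IsCompact A) : IsCompact (argminOn f A) := by
  have : argminOn f A = A ∩ ⋂ y ∈ A, f ⁻¹' Set.Iic (f y) := by
    ext x; simp [argminOn]
  rw [this]
  exact hA.inter_right (isClosed_biInter fun y _ => isClosed_Iic.preimage hf)

variable [MetricSpace T] [SecondCountableTopology T]

theorem measurable_biInf_inter {Γ : Ω → Set T} (hΓ : HitMeasurable m Γ)
    (hc : ∀ ω, IsCompact (Γ ω)) {f : Ω → T → EReal} (hf : IsCaratheodory m f)
    {K : Set T} (hK : IsCompact K) : Measurable fun ω => ⨅ x ∈ Γ ω ∩ K, f ω x := by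
  refine measurable_of_Iic fun a => ?_
  -- An empty intersection has infimum `⊤`, so only `a < ⊤` forces a minimizer to exist.
  rcases eq_or_ne a ⊤ with rfl | ha
  · simp
  convert measurableSet_exists_le hΓ (fun ω => (hc ω).isClosed) hf hK a using 1
  ext ω
  constructor
  · intro (hω : ⨅ x ∈ Γ ω ∩ K, f ω x ≤ a)
    have hne : (Γ ω ∩ K).Nonempty := by
      by_contra hne
      rw [Set.not_nonempty_iff_eq_empty.1 hne] at hω
      simp [ha] at hω
    obtain ⟨x, hx⟩ := exists_mem_argminOn (hf.2 ω) ((hc ω).inter hK) hne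
    exact ⟨x, hx.1, (biInf_eq_of_mem_argminOn hx).symm.trans_le hω⟩
  · rintro ⟨x, hx, hxa⟩
    exact le_trans (iInf₂_le (f := fun x _ => f ω x) x hx) hxa

theorem measurable_biInf [ProperSpace T] {Γ : Ω → Set T} (hΓ : HitMeasurable m Γ)
    (hc : ∀ ω, IsCompact (Γ ω)) {f : Ω → T → EReal} (hf : IsCaratheodory m f) :
    Measurable fun ω => ⨅ x ∈ Γ ω, f ω x := by
  have : (fun ω => ⨅ x ∈ Γ ω, f ω x) =
      fun ω => ⨅ n : ℕ, ⨅ x ∈ Γ ω ∩ compactCovering T n, f ω x := by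
    ext ω
    refine le_antisymm (le_iInf fun n => biInf_mono fun x hx => hx.1) (le_iInf₂ fun x hx => ?_)
    obtain ⟨n, hn⟩ := exists_mem_compactCovering x
    exact (iInf_le _ n).trans (iInf₂_le x ⟨hx, hn⟩)
  rw [this]
  exact Measurable.iInf fun n => measurable_biInf_inter hΓ hc hf (isCompact_compactCovering T n)

/-- Some minimizer lies in `K` exactly when `Γ ω` meets `K` and restricting to `K` does not raise
the infimum. -/
theorem HitMeasurable.argminOn [ProperSpace T] {Γ : Ω → Set T} (hΓ : HitMeasurable m Γ)
    (hc : ∀ ω, IsCompact (Γ ω)) {f : Ω → T → EReal} (hf : IsCaratheodory m f) :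
    HitMeasurable m fun ω => argminOn (f ω) (Γ ω) := by
  intro K hK
  have : {ω | (FundLemma.argminOn (f ω) (Γ ω) ∩ K).Nonempty} =
      {ω | (Γ ω ∩ K).Nonempty} ∩
        {ω | ⨅ x ∈ Γ ω ∩ K, f ω x ≤ ⨅ x ∈ Γ ω, f ω x} := by
    ext ω
    constructor
    · rintro ⟨x, hx, hxK⟩
      refine ⟨⟨x, hx.1, hxK⟩, ?_⟩
      change ⨅ x ∈ Γ ω ∩ K, f ω x ≤ ⨅ x ∈ Γ ω, f ω x
      exact (iInf₂_le x ⟨hx.1, hxK⟩).trans (biInf_eq_of_mem_argminOn hx).ge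
    · rintro ⟨hne, hle⟩
      change ⨅ x ∈ Γ ω ∩ K, f ω x ≤ ⨅ x ∈ Γ ω, f ω x at hle
      obtain ⟨x, hx⟩ := exists_mem_argminOn (hf.2 ω) ((hc ω).inter hK) hne
      refine ⟨x, ⟨hx.1.1, fun y hy => ?_⟩, hx.1.2⟩
      exact (biInf_eq_of_mem_argminOn hx).ge.trans
        (hle.trans (iInf₂_le y hy))
  rw [this]
  exact (hΓ K hK).inter
    (measurableSet_le (measurable_biInf_inter hΓ hc hf hK) (measurable_biInf hΓ hc hf))

theorem HitMeasurable.measurable_of_singleton [ProperSpace T] [MeasurableSpace T] [BorelSpace T]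
    {X : Ω → T} (hX : HitMeasurable m fun ω => {X ω}) : Measurable X := by
  refine measurable_of_isClosed fun F hF => ?_
  have : X ⁻¹' F = ⋃ n : ℕ, {ω | (({X ω} : Set T) ∩ (F ∩ compactCovering T n)).Nonempty} := by
    ext ω
    simp only [Set.singleton_inter_nonempty, Set.mem_iUnion, Set.mem_ofPred_eq, Set.mem_inter_iff,
      Set.mem_preimage, exists_and_left]
    exact ⟨fun h => ⟨h, exists_mem_compactCovering _⟩, fun h => h.1⟩
  rw [this]
  exact MeasurableSet.iUnion fun n => hX _ ((isCompact_compactCovering T n).inter_left hF)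

/-- Lexicographic minimization: minimizing the coordinates one after another keeps the sets compact
and hit-measurable, and leaves a single point. -/
theorem HitMeasurable.exists_measurable_selection {N : ℕ} {Γ : Ω → Set (Rn N)}
    (hΓ : HitMeasurable m Γ) (hc : ∀ ω, IsCompact (Γ ω)) (hne : ∀ ω, (Γ ω).Nonempty) :
    ∃ X : Ω → Rn N, Measurable X ∧ ∀ ω, X ω ∈ Γ ω := by
  have key : ∀ l : List (Fin N), ∃ Γ' : Ω → Set (Rn N), HitMeasurable m Γ' ∧
      (∀ ω, IsCompact (Γ' ω)) ∧ (∀ ω, (Γ' ω).Nonempty) ∧ (∀ ω, Γ' ω ⊆ Γ ω) ∧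
      ∀ ω, ∀ i ∈ l, ∀ x ∈ Γ' ω, ∀ y ∈ Γ' ω, x i = y i := by
    intro l
    induction l with
    | nil => exact ⟨Γ, hΓ, hc, hne, fun _ => subset_rfl, by simp⟩
    | cons i l ih =>
      obtain ⟨Γ', h1, h2, h3, h4, h5⟩ := ih
      have hf : IsCaratheodory m fun (_ : Ω) (x : Rn N) => ((x i : ℝ) : EReal) :=
        ⟨fun x => measurable_const, fun _ => continuous_coe_real_ereal.comp (by fun_prop)⟩
      refine ⟨_, h1.argminOn h2 hf, fun ω => isCompact_argminOn (hf.2 ω) (h2 ω),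
        fun ω => exists_mem_argminOn (hf.2 ω) (h2 ω) (h3 ω),
        fun ω x hx => h4 ω hx.1, fun ω j hj x hx y hy => ?_⟩
      rcases List.mem_cons.1 hj with rfl | hj
      · exact EReal.coe_injective (le_antisymm (hx.2 y hy.1) (hy.2 x hx.1))
      · exact h5 ω j hj x hx.1 y hy.1
  obtain ⟨Γ', h1, -, h3, h4, h5⟩ := key (List.finRange N)
  choose X hX using h3
  have hs : Γ' = fun ω => {X ω} := by
    ext ω x
    refine ⟨fun hx => ?_, fun hx => by rw [Set.mem_singleton_iff.1 hx]; exact hX ω⟩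
    ext i
    exact h5 ω i (List.mem_finRange i) x hx _ (hX ω)
  exact ⟨X, (hs ▸ h1).measurable_of_singleton, fun ω => h4 ω (hX ω)⟩

end Selection

/-- The `z` for which `𝒳 z` meets a compact set form a closed set. -/
theorem IsClosedMultifunction.hitMeasurable_comp {Ω S T : Type*} {m : MeasurableSpace Ω}
    [MetricSpace S] [MeasurableSpace S] [BorelSpace S] [MetricSpace T]
    {𝒳 : S → Set T} (h𝒳 : IsClosedMultifunction 𝒳) {Z : Ω → S} (hZ : Measurable Z) :
    HitMeasurable m fun ω => 𝒳 (Z ω) := by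
  intro K hK
  have : IsClosed {z | (𝒳 z ∩ K).Nonempty} := by
    refine IsSeqClosed.isClosed fun z y hz hzy => ?_
    choose x hx hxK using hz
    obtain ⟨a, haK, φ, hφ, ha⟩ := hK.tendsto_subseq hxK
    exact ⟨a, h𝒳.2 _ _ _ _ ha (hzy.comp hφ.tendsto_atTop) fun k => hx _, haK⟩
  exact hZ this.measurableSet

/-! ### Extended real valued expectations. -/

section Expectation

variable {Ω : Type*} [MeasurableSpace Ω] {P : Measure Ω}

theorem expectation_congr_ae {f f' : Ω → EReal} (h : f =ᵐ[P] f') :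
    expectation P f = expectation P f' := by
  unfold expectation
  rw [lintegral_congr_ae (h.mono fun ω hω => congrArg EReal.toENNReal hω),
    lintegral_congr_ae (h.mono fun ω hω => congrArg (fun y => (-y).toENNReal) hω)]

theorem lintegral_toENNReal_coe_lt_top {F : Ω → ℝ} (hF : Integrable F P) :
    ∫⁻ ω, ((F ω : ℝ) : EReal).toENNReal ∂P < ∞ := by
  simp only [EReal.toENNReal_of_ne_top (EReal.coe_ne_top _), EReal.toReal_coe]
  exact hF.lintegral_lt_top

theorem expectation_coe {F : Ω → ℝ} (hF : Integrable F P) :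
    expectation P (fun ω => (F ω : EReal)) = ((∫ ω, F ω ∂P : ℝ) : EReal) := by
  have h1 := hF.lintegral_lt_top
  have h2 := hF.neg.lintegral_lt_top
  simp only [expectation, ← EReal.coe_neg, EReal.toENNReal_of_ne_top (EReal.coe_ne_top _),
    EReal.toReal_coe]
  rw [integral_eq_lintegral_pos_part_sub_lintegral_neg_part hF, EReal.coe_sub,
    EReal.coe_ennreal_toReal h1.ne, EReal.coe_ennreal_toReal]
  exact h2.ne

end Expectation

/-! ### Substituting a measurable decision into the conditional expectation. -/

section Substitution

variable {Ω : Type*} {m mΩ : MeasurableSpace Ω} {P : Measure Ω}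
  {N : ℕ} {g : Ω → Rn N → ℝ} {ψ : Ω → ℝ} {f : Ω → Rn N → EReal}

/-- One null set serves all `x`: the bound holds on a countable dense set and extends by continuity.
It also makes `f ω` finite, so `toReal` loses nothing there. -/
theorem ae_forall_condExpVersion_mem_Icc (hg : ∀ x, Integrable (fun ω => g ω x) P)
    (hψ : Integrable ψ P) (hgψ : ∀ ω x, |g ω x| ≤ ψ ω)
    (hv : ∀ x, IsCondExpVersion P m (fun ω => g ω x) fun ω => f ω x)
    (hf : ∀ ω, Continuous (f ω)) :
    ∀ᵐ ω ∂P, ∀ x, f ω x ∈ Set.Icc ((-(P[ψ | m]) ω : ℝ) : EReal) (((P[ψ | m]) ω : ℝ) : EReal) := by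
  obtain ⟨D, hDc, hD⟩ := TopologicalSpace.exists_countable_dense (Rn N)
  have hae : ∀ᵐ ω ∂P, ∀ x ∈ D,
      f ω x ∈ Set.Icc ((-(P[ψ | m]) ω : ℝ) : EReal) (((P[ψ | m]) ω : ℝ) : EReal) := by
    rw [ae_ball_iff hDc]
    intro x _
    have h1 : P[fun ω => g ω x | m] ≤ᵐ[P] P[ψ | m] := condExp_mono (hg x) hψ
      (Eventually.of_forall fun ω => (abs_le.1 (hgψ ω x)).2)
    have h2 : P[-ψ | m] ≤ᵐ[P] P[fun ω => g ω x | m] := condExp_mono hψ.neg (hg x)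
      (Eventually.of_forall fun ω => (abs_le.1 (hgψ ω x)).1)
    filter_upwards [h1, h2, condExp_neg ψ m, (hv x).2] with ω h1 h2 h3 h4
    rw [h4, Set.mem_Icc, EReal.coe_le_coe_iff, EReal.coe_le_coe_iff]
    rw [h3] at h2
    exact ⟨h2, h1⟩
  filter_upwards [hae] with ω hω x
  have : closure D ⊆ f ω ⁻¹' Set.Icc ((-(P[ψ | m]) ω : ℝ) : EReal) (((P[ψ | m]) ω : ℝ) : EReal) :=
    (isClosed_Icc.preimage (hf ω)).closure_subset_iff.2 hω
  exact this (hD x)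

theorem abs_toReal_le_of_mem_Icc {y : EReal} {b : ℝ}
    (hy : y ∈ Set.Icc ((-b : ℝ) : EReal) (b : EReal)) : |y.toReal| ≤ b ∧ (y.toReal : EReal) = y := by
  induction y with
  | bot => simp at hy
  | top => simp at hy
  | coe y =>
    rw [Set.mem_Icc, EReal.coe_le_coe_iff, EReal.coe_le_coe_iff] at hy
    exact ⟨abs_le.2 hy, rfl⟩

theorem measurable_eval_of_isCaratheodory {T : Type*} [TopologicalSpace T]
    [TopologicalSpace.PseudoMetrizableSpace T] [MeasurableSpace T] [BorelSpace T]
    {H : Ω → Rn N → T} (hH : IsCaratheodory mΩ H) {X : Ω → Rn N} (hX : Measurable X) :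
    Measurable fun ω => H ω (X ω) := by
  refine measurable_of_tendsto_metrizable (f := fun n ω => H ω (hX.stronglyMeasurable.approx n ω))
    (fun n => ?_) (tendsto_pi_nhds.2 fun ω =>
      ((hH.2 ω).tendsto _).comp (hX.stronglyMeasurable.tendsto_approx ω))
  exact (hX.stronglyMeasurable.approx n).measurable_bind (fun x ω => H ω x) hH.1

/-- On each level set of `s`, which lies in `m`, this is the defining property of conditional
expectation. -/
theorem integral_substitution_of_mem_finset [IsFiniteMeasure P] (hm : m ≤ mΩ)
    (hg : ∀ x, Integrable (fun ω => g ω x) P)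
    (hv : ∀ x, IsCondExpVersion P m (fun ω => g ω x) fun ω => f ω x)
    {s : Ω → Rn N} (hS : ∀ c, MeasurableSet[m] (s ⁻¹' {c})) {R : Finset (Rn N)}
    (hR : ∀ ω, s ω ∈ R) :
    ∫ ω, g ω (s ω) ∂P = ∫ ω, (f ω (s ω)).toReal ∂P := by
  have hint : ∀ x, Integrable (fun ω => (f ω x).toReal) P := fun x =>
    (integrable_condExp (m := m) (f := fun ω => g ω x)).congr ((hv x).2.mono fun ω hω => by
      simp only [hω, EReal.toReal_coe])
  have hsum : ∀ F : Ω → Rn N → ℝ, (∀ x, Integrable (fun ω => F ω x) P) →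
      ∫ ω, F ω (s ω) ∂P = ∑ c ∈ R, ∫ ω in s ⁻¹' {c}, F ω c ∂P := by
    intro F hF
    have : (fun ω => F ω (s ω)) =
        fun ω => ∑ c ∈ R, (s ⁻¹' {c}).indicator (fun ω => F ω c) ω := by
      ext ω
      rw [Finset.sum_eq_single (s ω)]
      · simp
      · intro c _ hc
        exact Set.indicator_of_notMem (fun h => hc h.symm) _
      · intro h
        exact absurd (hR ω) h
    rw [this, integral_finsetSum _ fun c _ => (hF c).indicator (hm _ (hS c))]
    exact Finset.sum_congr rfl fun c _ => integral_indicator (hm _ (hS c))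
  rw [hsum g hg, hsum (fun ω x => (f ω x).toReal) hint]
  refine Finset.sum_congr rfl fun c _ => ?_
  rw [← setIntegral_condExp hm (hg c) (hS c)]
  exact integral_congr_ae (ae_restrict_of_ae
    ((hv c).2.mono fun ω hω => by simp only [hω, EReal.toReal_coe]))

theorem integral_substitution [IsFiniteMeasure P] (hm : m ≤ mΩ)
    (hg : IsCaratheodory mΩ g)
    (hψ : Integrable ψ P) (hgψ : ∀ ω x, |g ω x| ≤ ψ ω)
    (hv : ∀ x, IsCondExpVersion P m (fun ω => g ω x) fun ω => f ω x)
    (hf : ∀ ω, Continuous (f ω)) {X : Ω → Rn N} (hX : Measurable[m] X) :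
    Integrable (fun ω => g ω (X ω)) P ∧ Integrable (fun ω => (f ω (X ω)).toReal) P ∧
      ∫ ω, g ω (X ω) ∂P = ∫ ω, (f ω (X ω)).toReal ∂P := by
  have hgX : ∀ X' : Ω → Rn N, Measurable[m] X' → Measurable fun ω => g ω (X' ω) :=
    fun X' hX' => measurable_eval_of_isCaratheodory hg (hX'.mono hm le_rfl)
  have hfX : ∀ X' : Ω → Rn N, Measurable[m] X' → Measurable fun ω => (f ω (X' ω)).toReal :=
    fun X' hX' => (measurable_eval_of_isCaratheodory ⟨fun x => (hv x).1.mono hm le_rfl, hf⟩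
      (hX'.mono hm le_rfl)).ereal_toReal
  have hgi : ∀ x, Integrable (fun ω => g ω x) P := fun x =>
    hψ.mono' (hg.1 x).aestronglyMeasurable (Eventually.of_forall fun ω => hgψ ω x)
  have hb := ae_forall_condExpVersion_mem_Icc hgi hψ hgψ hv hf
  refine ⟨hψ.mono' (hgX X hX).aestronglyMeasurable (Eventually.of_forall fun ω => hgψ ω _),
    (integrable_condExp (m := m) (f := ψ)).mono' (hfX X hX).aestronglyMeasurable
      (hb.mono fun ω hω => (abs_toReal_le_of_mem_Icc (hω _)).1), ?_⟩
  have hXs : StronglyMeasurable[m] X := hX.stronglyMeasurable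
  have hs : ∀ n, Measurable[m] (hXs.approx n) := fun n => @SimpleFunc.measurable _ _ m _ _
  have h1 : Tendsto (fun n => ∫ ω, g ω (hXs.approx n ω) ∂P) atTop (𝓝 (∫ ω, g ω (X ω) ∂P)) :=
    tendsto_integral_of_dominated_convergence ψ
      (fun n => (hgX _ (hs n)).aestronglyMeasurable) hψ
      (fun n => Eventually.of_forall fun ω => hgψ ω _)
      (Eventually.of_forall fun ω => ((hg.2 ω).tendsto _).comp (hXs.tendsto_approx ω))
  have h2 : Tendsto (fun n => ∫ ω, (f ω (hXs.approx n ω)).toReal ∂P) atTop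
      (𝓝 (∫ ω, (f ω (X ω)).toReal ∂P)) := by
    refine tendsto_integral_of_dominated_convergence (P[ψ | m])
      (fun n => (hfX _ (hs n)).aestronglyMeasurable) integrable_condExp
      (fun n => hb.mono fun ω hω => (abs_toReal_le_of_mem_Icc (hω _)).1)
      (hb.mono fun ω hω => ?_)
    -- `toReal` is continuous only away from `±∞`, so the limit value must be finite.
    have hcoe := (abs_toReal_le_of_mem_Icc (hω (X ω))).2
    refine (EReal.tendsto_toReal ?_ ?_).comp
      (((hf ω).tendsto _).comp (hXs.tendsto_approx ω))
    · rw [← hcoe]; exact EReal.coe_ne_top _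
    · rw [← hcoe]; exact EReal.coe_ne_bot _
  refine tendsto_nhds_unique h1 (h2.congr fun n => (integral_substitution_of_mem_finset hm hgi hv
    (fun c => hs n (measurableSet_singleton c)) (R := @SimpleFunc.range _ _ m (hXs.approx n))
    fun ω => @SimpleFunc.mem_range_self _ _ m _ ω).symm)

end Substitution

end FundLemma

theorem mainTheorem2
    {Ω : Type*} [MeasurableSpace Ω] (P : Measure Ω) [IsProbabilityMeasure P]
    (M N : ℕ)
    (Y : Ω → FundLemma.Rn M) (hY : Measurable Y)
    (g : Ω → FundLemma.Rn N → ℝ)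
    (hg : ∀ x, FundLemma.ExpectationExists P (fun ω => (g ω x : EReal)))
    (𝒳 : FundLemma.Rn N → Set (FundLemma.Rn N)) (hdom : FundLemma.multiDom 𝒳 = Set.univ)
    (Z : Ω → FundLemma.Rn N)
    (C1 : (∀ z, IsCompact (𝒳 z)) ∧ FundLemma.IsClosedMultifunction 𝒳)
    (C2 : Measurable[FundLemma.sigmaOf Y] Z) :
    (FundLemma.decisionSet P (FundLemma.sigmaOf Y) 𝒳 Z).Nonempty ∧
    ∀ (_C3 : (∀ X ∈ FundLemma.decisionSet P (FundLemma.sigmaOf Y) 𝒳 Z,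
          FundLemma.ExpectationExists P (fun ω => (g ω (X ω) : EReal))) ∧
        (⨅ X ∈ FundLemma.decisionSet P (FundLemma.sigmaOf Y) 𝒳 Z,
          FundLemma.expectation P (fun ω => (g ω (X ω) : EReal))) < ⊤)
      (_C4 : ∃ ψ : Ω → ℝ, Integrable ψ P ∧ ∀ ω x, |g ω x| ≤ ψ ω)
      (_C5 : FundLemma.IsCaratheodory inferInstance g)
      (h : FundLemma.Rn M → FundLemma.Rn N → EReal)
      (_hh : ∀ x, FundLemma.IsCondExpVersion P (FundLemma.sigmaOf Y)
        (fun ω => g ω x) (fun ω => h (Y ω) x))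
      (_C6 : FundLemma.IsCaratheodory inferInstance (fun ω x => h (Y ω) x))
      (θ : Ω → EReal) (_hθ : ∀ ω, θ ω = ⨅ x ∈ 𝒳 (Z ω), h (Y ω) x),
      Measurable[FundLemma.sigmaOf Y] θ ∧
      FundLemma.ExpectationExists P θ ∧
      (∃ Xstar ∈ FundLemma.decisionSet P (FundLemma.sigmaOf Y) 𝒳 Z,
        (∀ ω, Xstar ω ∈ FundLemma.argminOn (h (Y ω)) (𝒳 (Z ω))) ∧
        (⨅ X ∈ FundLemma.decisionSet P (FundLemma.sigmaOf Y) 𝒳 Z,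
          FundLemma.expectation P (fun ω => (g ω (X ω) : EReal))) =
            FundLemma.expectation P θ ∧
        FundLemma.expectation P θ =
          FundLemma.expectation P (fun ω => (g ω (Xstar ω) : EReal))) ∧
      (∀ X : Ω → FundLemma.Rn N,
        (∀ ω, FundLemma.argminOn (h (Y ω)) (𝒳 (Z ω)) = {X ω}) →
          Measurable[FundLemma.sigmaOf Y] X) := by
  have hm := hY.comap_le
  have hne : ∀ z, (𝒳 z).Nonempty := fun z => by
    have : z ∈ FundLemma.multiDom 𝒳 := hdom ▸ Set.mem_univ z
    exact this
  have hΓ : FundLemma.HitMeasurable (FundLemma.sigmaOf Y) fun ω => 𝒳 (Z ω) :=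
    C1.2.hitMeasurable_comp C2
  have hc : ∀ ω, IsCompact (𝒳 (Z ω)) := fun ω => C1.1 _
  refine ⟨?_, ?_⟩
  · obtain ⟨X, hX, hmem⟩ := hΓ.exists_measurable_selection hc fun ω => hne _
    exact ⟨X, Eventually.of_forall hmem, hX⟩
  rintro - ⟨ψ, hψ, hgψ⟩ C5 h hh C6 θ hθ
  -- `C6` gives measurability only for the ambient σ-algebra; the version property sharpens it to
  -- `σ{Y}`.
  have hf : FundLemma.IsCaratheodory (FundLemma.sigmaOf Y) fun ω x => h (Y ω) x :=
    ⟨fun x => (hh x).1, C6.2⟩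
  have hθm : Measurable[FundLemma.sigmaOf Y] θ := by
    rw [funext hθ]
    exact FundLemma.measurable_biInf hΓ hc hf
  have hΓa := hΓ.argminOn hc hf
  obtain ⟨Xs, hXs, hXmin⟩ := hΓa.exists_measurable_selection
    (fun ω => FundLemma.isCompact_argminOn (hf.2 ω) (hc ω))
    fun ω => FundLemma.exists_mem_argminOn (hf.2 ω) (hc ω) (hne _)
  have hgi : ∀ x, Integrable (fun ω => g ω x) P := fun x =>
    hψ.mono' (C5.1 x).aestronglyMeasurable (Eventually.of_forall fun ω => hgψ ω x)
  have hb := FundLemma.ae_forall_condExpVersion_mem_Icc hgi hψ hgψ hh hf.2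
  have hsub := fun (X : Ω → FundLemma.Rn N) (hX : Measurable[FundLemma.sigmaOf Y] X) =>
    FundLemma.integral_substitution hm C5 hψ hgψ hh hf.2 hX
  have hθX : ∀ ω, θ ω = h (Y ω) (Xs ω) := fun ω =>
    (hθ ω).trans (FundLemma.biInf_eq_of_mem_argminOn (hXmin ω))
  have hθae : θ =ᵐ[P] fun ω => (((h (Y ω) (Xs ω)).toReal : ℝ) : EReal) := by
    filter_upwards [hb] with ω hω
    rw [hθX, (FundLemma.abs_toReal_le_of_mem_Icc (hω _)).2]
  obtain ⟨hgXs, hhXs, heq⟩ := hsub Xs hXs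
  have hEθ : FundLemma.expectation P θ = ((∫ ω, g ω (Xs ω) ∂P : ℝ) : EReal) := by
    rw [FundLemma.expectation_congr_ae hθae, FundLemma.expectation_coe hhXs, heq]
  have hmem : Xs ∈ FundLemma.decisionSet P (FundLemma.sigmaOf Y) 𝒳 Z :=
    ⟨Eventually.of_forall fun ω => (hXmin ω).1, hXs⟩
  refine ⟨hθm, ⟨hθm.mono hm le_rfl, Or.inl ?_⟩, ⟨Xs, hmem, hXmin, ?_, ?_⟩, ?_⟩
  · rw [lintegral_congr_ae (hθae.mono fun ω hω => congrArg EReal.toENNReal hω)]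
    exact FundLemma.lintegral_toENNReal_coe_lt_top hhXs
  · refine le_antisymm ((iInf₂_le Xs hmem).trans ?_) (le_iInf₂ fun X hX => ?_)
    · rw [hEθ, FundLemma.expectation_coe hgXs]
    · obtain ⟨hgX, hhX, hXeq⟩ := hsub X hX.2
      rw [hEθ, FundLemma.expectation_coe hgX, EReal.coe_le_coe_iff, hXeq, heq]
      refine integral_mono_ae hhXs hhX ?_
      filter_upwards [hb, hX.1] with ω hω hXω
      rw [← EReal.coe_le_coe_iff, (FundLemma.abs_toReal_le_of_mem_Icc (hω _)).2,
        (FundLemma.abs_toReal_le_of_mem_Icc (hω _)).2]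
      exact (hXmin ω).2 _ hXω
  · rw [hEθ, FundLemma.expectation_coe hgXs]
  · intro X hX
    -- Under uniqueness the hit-measurable argmin multifunction is `{X ω}` itself.
    rw [funext hX] at hΓa
    exact hΓa.measurable_of_singleton
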